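/- A numbered graph $(\Gamma,N)$ is a finite simple graph $\Gamma$ with vertex set $V\Gamma$ together with a map $N$ from $V\Gamma$ to the positive integers. For $U\subseteq V\Gamma$ let $N(U)$ denote the multiset $\{N(v)\mid v\in U\}$. A clique is a set $\sigma$ of vertices spanning a complete subgraph (the empty set is allowed), and its link is $\mathrm{Lk}(\sigma)=\{v\in V\Gamma\setminus\sigma\mid \{v\}\cup\sigma\text{ is a clique}\}$. The numbered graph $(\Gamma,N)$ is link-regular if, for all cliques $\sigma_1,\sigma_2$ of $\Gamma$, $N(\sigma_1)=N(\sigma_2)$ implies $N(\mathrm{Lk}(\sigma_1))=N(\mathrm{Lk}(\sigma_2))$. Two link-regular numbered graphs $(\Gamma,N)$ and $(\Gamma',N')$ are equivalent if (i) $N(V\Gamma)=N'(V\Gamma')$, and (ii) whenever $\sigma$ is a clique of $\Gamma$ and $\sigma'$ is a clique of $\Gamma'$ with $N(\sigma)=N'(\sigma')$, we have $N(\mathrm{Lk}(\sigma))=N'(\mathrm{Lk}(\sigma'))$. (For numbered graphs satisfying (i), being link-regular and equivalent means exactly that their disjoint union is link-regular.) The numbered graph product $\mathrm{NGP}(\Gamma)$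 is the group $$\bigl\langle v\in V\Gamma \bigm| v^{N(v)}=1 \text{ for all } v\in V\Gamma,\ uv=vu\text{ for all edges }\{u,v\}\text{ of }\Gamma\bigr\rangle,$$ and its standard generating set is $S=V\Gamma\cup (V\Gamma)^{-1}$, regarded as a subset of the group. A word over $S$ is a geodesic if no shorter word over $S$ represents the same group element. The geodesic growth series of $\mathrm{NGP}(\Gamma)$ is the formal power series $\sum_{n\ge 0}g_nz^n$, where $g_n$ is the number of geodesic words over $S$ of length $n$. **Theorem.** If $(\Gamma,N)$ and $(\Gamma',N')$ are equivalent link-regular numbered graphs, then $\mathrm{NGP}(\Gamma)$ and $\mathrm{NGP}(\Gamma')$ have the same geodesic growth series. -/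

import Mathlib

universe u v

section Words

/-- The growth series `∑ |L ∩ Aⁿ| zⁿ` of a language `L` over the alphabet `A`: the coefficient
of `zⁿ` is the number of words of length `n` in `L`. (For a finite alphabet, the case of interest,
there are finitely many such words.) -/
noncomputable def Language.growthSeries {A : Type u} (L : Language A) : PowerSeries ℕ :=
  PowerSeries.mk fun n => Set.ncard {w : List A | w ∈ L ∧ w.length = n}

variable {G : Type u} [Group G]

/-- Evaluation in `G` of a word over a subset `S` of `G`. -/
def wordEval (S : Set G) (w : List S) : G := (w.map Subtype.val).prod

/-- A word over `S` is geodesic if no shorter word over `S` evaluates to the same element.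
(`S` is meant to be a symmetric generating set of `G`.) -/
def IsGeodesicWord (S : Set G) (w : List S) : Prop :=
  ¬ ∃ y : List S, y.length < w.length ∧ wordEval S y = wordEval S w

/-- The language over the alphabet `S` of all geodesic words of `(G, S)`. -/
def geodesicLanguage (S : Set G) : Language S := {w : List S | IsGeodesicWord S w}

/-- The geodesic growth series of `(G, S)`. -/
noncomputable def geodesicGrowthSeries (S : Set G) : PowerSeries ℕ :=
  (geodesicLanguage S).growthSeries

end Words

/-- A numbered graph on the vertex set `V`: a simple graph together with a positive integer
for every vertex. -/
structure NumberedGraph (V : Type u) where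
  /-- the underlying simple graph -/
  graph : SimpleGraph V
  /-- the vertex numbers -/
  num : V → ℕ
  num_pos : ∀ x, 0 < num x

namespace NumberedGraph

variable {V : Type u} {V' : Type v}

/-- The defining relators of the numbered graph product: `x ^ N(x)` for every vertex `x`, and the
commutator `x y x⁻¹ y⁻¹` for every edge `{x, y}`. -/
def relators (Γ : NumberedGraph V) : Set (FreeGroup V) :=
  {r | ∃ x, r = FreeGroup.of x ^ Γ.num x} ∪
    {r | ∃ x y, Γ.graph.Adj x y ∧
      r = FreeGroup.of x * FreeGroup.of y * (FreeGroup.of x)⁻¹ * (FreeGroup.of y)⁻¹}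

/-- The numbered graph product: the graph product over `Γ` of the cyclic groups
`⟨x | x ^ N(x) = 1⟩`, given by its presentation. -/
abbrev NGP (Γ : NumberedGraph V) : Type u := PresentedGroup Γ.relators

/-- The element of the numbered graph product given by a vertex. -/
def gen (Γ : NumberedGraph V) (x : V) : Γ.NGP := PresentedGroup.of x

/-- The standard generating set `V ∪ V⁻¹`, as a subset of the numbered graph product (so a
generator of order two and its inverse count as one letter). -/
def stdGens (Γ : NumberedGraph V) : Set Γ.NGP :=
  {g | ∃ x, g = Γ.gen x ∨ g = (Γ.gen x)⁻¹}

/-- The multiset `N(U) = {N(x) | x ∈ U}`. -/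
def numbers (Γ : NumberedGraph V) (U : Finset V) : Multiset ℕ := U.val.map Γ.num

/-- A finite set of vertices that spans a complete subgraph (the empty set is allowed). -/
def IsClique (Γ : NumberedGraph V) (σ : Finset V) : Prop := Γ.graph.IsClique (σ : Set V)

open Classical in
/-- The link of `σ`: the vertices `x ∉ σ` such that `{x} ∪ σ` is a clique. -/
noncomputable def link [Fintype V] (Γ : NumberedGraph V) (σ : Finset V) : Finset V :=
  {x : V | x ∉ σ ∧ Γ.IsClique (insert x σ)}

/-- Link-regularity: the vertex numbers of a clique determine those of its link. -/
def LinkRegular [Fintype V] (Γ : NumberedGraph V) : Prop :=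
  ∀ σ₁ σ₂ : Finset V, Γ.IsClique σ₁ → Γ.IsClique σ₂ →
    Γ.numbers σ₁ = Γ.numbers σ₂ → Γ.numbers (Γ.link σ₁) = Γ.numbers (Γ.link σ₂)

/-- Equivalence (for link-regular numbered graphs): the same multiset of vertex numbers, and
cliques with the same vertex numbers, one in each graph, have links with the same vertex
numbers. -/
structure Equivalent [Fintype V] [Fintype V'] (Γ : NumberedGraph V) (Γ' : NumberedGraph V') :
    Prop where
  numbers_univ : Γ.numbers Finset.univ = Γ'.numbers Finset.univ
  numbers_link : ∀ (σ : Finset V) (σ' : Finset V'), Γ.IsClique σ → Γ'.IsClique σ' →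
    Γ.numbers σ = Γ'.numbers σ' → Γ.numbers (Γ.link σ) = Γ'.numbers (Γ'.link σ')

end NumberedGraph

/-! Geodesics are recognised by an automaton whose state records, for each vertex, the exponent of
its syllable that can be commuted to the end of the word. The support of a reachable state is a
clique. A letter may be read if it lengthens its syllable without passing half the vertex number.

Accepted means geodesic. A letter that cannot be read cancels into its syllable or pushes it past
half the order, so the word shortens (`exists_shorter`). Conversely, for each vertex `v` the group
maps to a semidirect product whose normal factor is a free product of copies of the vertex group of
`v`, indexed by cosets of the link subgroup. The norm of the free product component bounds below the
number of `v`-letters of any representative, with equality for accepted words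
(`norm_and_head_of_accepts`). Accepted words thus minimise all letter counts at once.

The accepted words are then compared by induction on length (`acceptedCount_eq`). Equivalence of the
graphs gives, for each subset of a clique, equal numbers of common neighbours with a given vertex
number; inclusion-exclusion refines this to exact adjacency patterns (`exists_equiv_adj_iff`). The
resulting vertex bijection matches readable letters and successor states. It need not be a graph
isomorphism, since a new one is chosen at every step. -/

/-! ### Counting fibers and inclusion-exclusion. -/

section Fibers

/-- Two functions on finite types whose fibers have the same cardinalities differ by a
bijection of their domains. -/
theorem exists_equiv_comp_eq {α β κ : Type*} [Finite α] [Finite β] (f : α → κ) (g : β → κ)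
    (h : ∀ k, Nat.card {a // f a = k} = Nat.card {b // g b = k}) :
    ∃ e : α ≃ β, ∀ a, g (e a) = f a := by
  have e (k : κ) : {a // f a = k} ≃ {b // g b = k} :=
    (Finite.card_eq.mp (h k)).some
  refine ⟨(Equiv.sigmaFiberEquiv f).symm.trans
    ((Equiv.sigmaCongrRight e).trans (Equiv.sigmaFiberEquiv g)), fun a => ?_⟩
  exact (e (f a) ⟨a, rfl⟩).2

-- Isolating the exact value `T` lets the counts of supersets determine exact counts by downward
-- induction.
open Classical in
theorem card_filter_subset_eq_add_sum {ι α : Type*} [Fintype α] (s : Finset ι) (F : ι → Finset α)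
    (T : Finset α) :
    (s.filter fun i => T ⊆ F i).card = (s.filter fun i => F i = T).card +
      ∑ U ∈ Finset.univ.filter (fun U => T ⊂ U), (s.filter fun i => F i = U).card := by
  have h1 : (s.filter fun i => T ⊆ F i).card =
      (s.filter fun i => F i = T).card + (s.filter fun i => T ⊂ F i).card := by
    rw [← Finset.card_union_of_disjoint]
    · congr 1
      ext i
      simp only [Finset.mem_filter, Finset.mem_union, ← and_or_left, ssubset_iff_subset_ne]
      refine and_congr_right fun _ => ⟨fun hT => ?_, ?_⟩
      · by_cases hE : F i = T
        · exact Or.inl hE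
        · exact Or.inr ⟨hT, fun h' => hE h'.symm⟩
      · rintro (h' | h')
        · exact h'.ge
        · exact h'.1
    · rw [Finset.disjoint_filter]
      intro i _ h1 h2
      exact h2.ne h1.symm
  rw [h1, Finset.card_eq_sum_card_fiberwise (s := s.filter fun i => T ⊂ F i) (f := F)
    (t := Finset.univ.filter fun U => T ⊂ U) (fun i hi => by
      simpa using (Finset.mem_filter.mp hi).2)]
  congr 1
  refine Finset.sum_congr rfl fun U hU => ?_
  congr 1
  ext i
  simp only [Finset.mem_filter, Finset.mem_univ, true_and] at hU ⊢
  constructor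
  · rintro ⟨⟨hi, _⟩, rfl⟩
    exact ⟨hi, rfl⟩
  · rintro ⟨hi, rfl⟩
    exact ⟨⟨hi, hU⟩, rfl⟩

open Classical in
/-- A finite family of finite sets is determined up to order by the number of members containing
each finite set. -/
theorem card_filter_eq_of_card_filter_subset_eq {ι ι' α : Type*} [Fintype α]
    (s : Finset ι) (s' : Finset ι') (F : ι → Finset α) (F' : ι' → Finset α)
    (h : ∀ T : Finset α, (s.filter fun i => T ⊆ F i).card = (s'.filter fun i => T ⊆ F' i).card)
    (T : Finset α) :
    (s.filter fun i => F i = T).card = (s'.filter fun i => F' i = T).card := by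
  refine Finset.strongDownwardInductionOn (n := Fintype.card α)
    (p := fun T => (s.filter fun i => F i = T).card = (s'.filter fun i => F' i = T).card) T
    (fun T ih _ => ?_) (Finset.card_le_univ T)
  have hT := h T
  rw [card_filter_subset_eq_add_sum, card_filter_subset_eq_add_sum,
    Finset.sum_congr rfl fun U hU => ih (Finset.card_le_univ U) (Finset.mem_filter.mp hU).2] at hT
  exact Nat.add_right_cancel hT

open Classical in
theorem card_subtype_prod_eq {U α : Type*} [Fintype U] (q : U → Prop) (N : U → ℕ)
    (D : U → Finset α)
    (m : ℕ) (T : Finset α) :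
    Nat.card {x : {x // ¬ q x} // (N x, D x) = (m, T)} =
      ((Finset.univ.filter fun x => ¬ q x ∧ N x = m).filter fun x => D x = T).card := by
  rw [Finset.filter_filter, ← Fintype.card_subtype, Nat.card_eq_fintype_card]
  exact Fintype.card_congr
    ⟨fun x => ⟨x.1.1, ⟨x.1.2, (Prod.ext_iff.mp x.2).1⟩, (Prod.ext_iff.mp x.2).2⟩,
      fun x => ⟨⟨x.1, x.2.1.1⟩, Prod.ext x.2.1.2 x.2.2⟩, fun _ => rfl, fun _ => rfl⟩

end Fibers

namespace NumberedGraph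

variable {V : Type u} {V' : Type v}

/-! ### The geodesic automaton. -/

section Automaton

variable (Γ : NumberedGraph V)

open Classical in
/-- The states of the geodesic automaton are the families of exponents of the syllables that can
be moved to the end of the word read so far; `step` is the effect of reading one more letter. -/
noncomputable def step (t : V → ℤ) (a : V × ℤˣ) : V → ℤ := fun x =>
  if x = a.1 then t x + a.2 else if Γ.graph.Adj a.1 x then t x else 0

/-- The letters that the geodesic automaton can read in the state `t`. For a vertex of number two,
only one of the two letters is used, since they represent the same element. -/
def Allowed (t : V → ℤ) (a : V × ℤˣ) : Prop :=
  0 ≤ a.2 * t a.1 ∧ 2 * (a.2 * t a.1 + 1) ≤ Γ.num a.1 ∧ (Γ.num a.1 = 2 → a.2 = 1)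

/-- The words accepted by the geodesic automaton started in the state `t`. -/
def Accepts : (V → ℤ) → List (V × ℤˣ) → Prop
  | _, [] => True
  | t, a :: w => Γ.Allowed t a ∧ Accepts (Γ.step t a) w

/-- The state reached by reading a word. -/
noncomputable def run (t : V → ℤ) (w : List (V × ℤˣ)) : V → ℤ := w.foldl Γ.step t

open Classical in
/-- The number of accepted words of a given length. -/
noncomputable def acceptedCount [Fintype V] : ℕ → (V → ℤ) → ℕ
  | 0, _ => 1
  | n + 1, t => ∑ a : V × ℤˣ, if Γ.Allowed t a then acceptedCount n (Γ.step t a) else 0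

variable {Γ}

theorem accepts_append {t : V → ℤ} {w w' : List (V × ℤˣ)} :
    Γ.Accepts t (w ++ w') ↔ Γ.Accepts t w ∧ Γ.Accepts (Γ.run t w) w' := by
  induction w generalizing t with
  | nil => simp [Accepts, run]
  | cons a w ih => simp only [List.cons_append, Accepts, ih, and_assoc]; rfl

theorem accepts_concat {t : V → ℤ} {w : List (V × ℤˣ)} {a : V × ℤˣ} :
    Γ.Accepts t (w ++ [a]) ↔ Γ.Accepts t w ∧ Γ.Allowed (Γ.run t w) a := by
  simp [accepts_append, Accepts]

theorem run_concat {t : V → ℤ} {w : List (V × ℤˣ)} {a : V × ℤˣ} :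
    Γ.run t (w ++ [a]) = Γ.step (Γ.run t w) a := by
  simp [run]

theorem step_self (t : V → ℤ) (u : V) (s : ℤˣ) : Γ.step t (u, s) u = t u + s := by
  simp [step]

theorem step_of_adj (t : V → ℤ) {u x : V} (s : ℤˣ) (h : Γ.graph.Adj u x) :
    Γ.step t (u, s) x = t x := by
  simp [step, h, h.ne']

theorem step_of_not_adj (t : V → ℤ) {u x : V} (s : ℤˣ) (hne : u ≠ x) (h : ¬ Γ.graph.Adj u x) :
    Γ.step t (u, s) x = 0 := by
  simp [step, h, hne.symm]

/-- The number of accepted words of a given length, as a cardinality. -/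
theorem ncard_accepts [Fintype V] (n : ℕ) (t : V → ℤ) :
    Set.ncard {w | Γ.Accepts t w ∧ w.length = n} = Γ.acceptedCount n t := by
  classical
  -- Carrying an explicit finite set through the induction supplies the finiteness that `Set.ncard`
  -- needs.
  suffices H : ∃ W : Finset (List (V × ℤˣ)),
      (∀ w, w ∈ W ↔ Γ.Accepts t w ∧ w.length = n) ∧ W.card = Γ.acceptedCount n t by
    obtain ⟨W, hW, hc⟩ := H
    rw [← hc, ← Set.ncard_coe_finset]
    congr 1
    ext w
    simp [hW]
  induction n generalizing t with
  | zero =>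
    refine ⟨{[]}, fun w => ?_, by simp [acceptedCount]⟩
    rw [Finset.mem_singleton, List.length_eq_zero_iff]
    exact ⟨fun h => ⟨h ▸ trivial, h⟩, fun h => h.2⟩
  | succ n ih =>
    choose W hW hc using ih
    refine ⟨(Finset.univ.filter (Γ.Allowed t)).biUnion fun a =>
      (W (Γ.step t a)).map ⟨List.cons a, List.cons_injective⟩, fun w => ?_, ?_⟩
    · cases w with
      | nil => simp
      | cons a w =>
        simp only [Finset.mem_biUnion, Finset.mem_filter, Finset.mem_univ, true_and,
          Finset.mem_map, Function.Embedding.coeFn_mk, hW, List.cons.injEq, Accepts,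
          List.length_cons, Nat.add_right_cancel_iff]
        constructor
        · rintro ⟨b, hb, w', ⟨h1, h2⟩, rfl, rfl⟩
          exact ⟨⟨hb, h1⟩, h2⟩
        · rintro ⟨⟨hb, h1⟩, h2⟩
          exact ⟨a, hb, w, ⟨h1, h2⟩, rfl, rfl⟩
    · rw [Finset.card_biUnion]
      · simp only [Finset.card_map, hc, acceptedCount, Finset.sum_filter]
      · intro a _ b _ hab
        rw [Function.onFun, Finset.disjoint_left]
        intro w h1 h2
        simp only [Finset.mem_map, Function.Embedding.coeFn_mk] at h1 h2
        obtain ⟨w1, _, rfl⟩ := h1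
        obtain ⟨w2, _, h⟩ := h2
        exact hab (List.cons.inj h).1.symm

end Automaton

/-! ### Transfer of accepted-word counts between equivalent graphs. -/

section Comparison

variable [Fintype V] [Fintype V'] {Γ : NumberedGraph V} {Γ' : NumberedGraph V'}

theorem mem_link {σ : Finset V} (hσ : Γ.IsClique σ) {x : V} :
    x ∈ Γ.link σ ↔ x ∉ σ ∧ ∀ y ∈ σ, Γ.graph.Adj x y := by
  classical
  rw [link, Finset.mem_filter]
  simp only [Finset.mem_univ, true_and, IsClique]
  refine and_congr_right fun hx => ?_
  constructor
  · intro h y hy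
    exact h (by simp) (by simp [hy]) (fun e => hx (e ▸ hy))
  · intro h
    have := SimpleGraph.isClique_insert (G := Γ.graph) (s := (σ : Set V)) (a := x)
    have h2 := this.mpr ⟨hσ, fun y hy _ => h y hy⟩
    convert h2
    ext y
    simp

open Classical in
theorem card_link_eq (h : Γ.Equivalent Γ') {σ : Finset V} {σ' : Finset V'} (hσ : Γ.IsClique σ)
    (hσ' : Γ'.IsClique σ') (hn : Γ.numbers σ = Γ'.numbers σ') (m : ℕ) :
    ((Γ.link σ).filter fun x => Γ.num x = m).card =
      ((Γ'.link σ').filter fun x => Γ'.num x = m).card := by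
  have := congrArg (Multiset.count m) (h.numbers_link σ σ' hσ hσ' hn)
  simp only [numbers, Multiset.count_map] at this
  simpa only [Finset.card_def, Finset.filter_val, eq_comm (a := m)] using this

omit [Fintype V] [Fintype V'] in
theorem numbers_map {e : V ≃ V'} (he : ∀ x, Γ'.num (e x) = Γ.num x) (σ : Finset V) :
    Γ'.numbers (σ.map e.toEmbedding) = Γ.numbers σ := by
  simp [numbers, Finset.map_val, Multiset.map_map, he]

-- All of `σ \ T` lies in the link of `T` because `σ` is a clique; the remaining link vertices lie
-- outside `σ`.
open Classical in
theorem card_link_eq_add {σ T : Finset V} (hσ : Γ.IsClique σ) (hT : T ⊆ σ) (m : ℕ) :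
    ((Γ.link T).filter fun x => Γ.num x = m).card =
      (Finset.univ.filter fun x => (x ∉ σ ∧ Γ.num x = m) ∧ ∀ y ∈ T, Γ.graph.Adj x y).card +
      ((σ \ T).filter fun x => Γ.num x = m).card := by
  have hTc : Γ.IsClique T := hσ.subset (by exact_mod_cast hT)
  rw [← Finset.card_union_of_disjoint]
  · congr 1
    ext x
    simp only [Finset.mem_filter, mem_link hTc, Finset.mem_union, Finset.mem_univ, true_and,
      Finset.mem_sdiff]
    constructor
    · rintro ⟨⟨h1, h2⟩, h3⟩
      by_cases hx : x ∈ σ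
      · exact Or.inr ⟨⟨hx, h1⟩, h3⟩
      · exact Or.inl ⟨⟨hx, h3⟩, h2⟩
    · rintro (⟨⟨h1, h2⟩, h3⟩ | ⟨⟨h1, h2⟩, h3⟩)
      · exact ⟨⟨fun hx => h1 (hT hx), h3⟩, h2⟩
      · exact ⟨⟨h2, fun y hy => hσ h1 (hT hy) fun hxy => h2 (hxy ▸ hy)⟩, h3⟩
  · rw [Finset.disjoint_left]
    intro x
    simp only [Finset.mem_filter, Finset.mem_univ, true_and, Finset.mem_sdiff]
    tauto

-- Equivalence equates the link counts of `T` and its image; the contributions from inside the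
-- cliques match under `e` and cancel.
open Classical in
theorem card_outside_eq (h : Γ.Equivalent Γ') {e : V ≃ V'} (he : ∀ x, Γ'.num (e x) = Γ.num x)
    {σ : Finset V} (hσ : Γ.IsClique σ) (hσ' : Γ'.IsClique (σ.map e.toEmbedding)) {T : Finset V}
    (hT : T ⊆ σ) (m : ℕ) :
    (Finset.univ.filter fun x => (x ∉ σ ∧ Γ.num x = m) ∧ ∀ y ∈ T, Γ.graph.Adj x y).card =
      (Finset.univ.filter fun x => (x ∉ σ.map e.toEmbedding ∧ Γ'.num x = m) ∧
        ∀ y ∈ T, Γ'.graph.Adj x (e y)).card := by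
  have hTc : Γ.IsClique T := hσ.subset (by exact_mod_cast hT)
  have hT' : T.map e.toEmbedding ⊆ σ.map e.toEmbedding := Finset.map_subset_map.mpr hT
  have hTc' : Γ'.IsClique (T.map e.toEmbedding) := hσ'.subset (by exact_mod_cast hT')
  have key := card_link_eq h hTc hTc' (numbers_map he T).symm m
  have inside : ((σ \ T).filter fun x => Γ.num x = m).card =
      ((σ.map e.toEmbedding \ T.map e.toEmbedding).filter fun x => Γ'.num x = m).card := by
    refine Finset.card_bij (fun x _ => e x) ?_ ?_ ?_
    · intro x
      simp [he]
    · intro x _ y _ hxy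
      exact e.injective hxy
    · intro y hy
      refine ⟨e.symm y, ?_, by simp⟩
      have := he (e.symm y)
      simp_all
  rw [card_link_eq_add hσ hT, card_link_eq_add hσ' hT', inside] at key
  simp only [Finset.forall_mem_map, Equiv.coe_toEmbedding] at key
  exact Nat.add_right_cancel key

/-- A number-preserving bijection that maps a clique to a clique can be changed outside the clique
so as to respect adjacency to the clique. -/
theorem exists_equiv_adj_iff (h : Γ.Equivalent Γ') {e : V ≃ V'}
    (he : ∀ x, Γ'.num (e x) = Γ.num x) {σ : Finset V} (hσ : Γ.IsClique σ)
    (hσ' : Γ'.IsClique (σ.map e.toEmbedding)) :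
    ∃ f : V ≃ V', (∀ x, Γ'.num (f x) = Γ.num x) ∧ (∀ x ∈ σ, f x = e x) ∧
      ∀ x, ∀ y ∈ σ, (Γ'.graph.Adj (f x) (f y) ↔ Γ.graph.Adj x y) := by
  classical
  let p : V → Prop := fun x => x ∈ σ
  let p' : V' → Prop := fun x => x ∈ σ.map e.toEmbedding
  let F : {x // ¬ p x} → ℕ × Finset V := fun x =>
    (Γ.num x, σ.filter fun y => Γ.graph.Adj x y)
  let F' : {x // ¬ p' x} → ℕ × Finset V := fun x =>
    (Γ'.num x, σ.filter fun y => Γ'.graph.Adj x (e y))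
  obtain ⟨g, hg⟩ := exists_equiv_comp_eq F F' (by
    rintro ⟨m, T⟩
    refine (card_subtype_prod_eq p Γ.num (fun x => σ.filter fun y => Γ.graph.Adj x y) m T).trans
      (Eq.trans ?_ (card_subtype_prod_eq p' Γ'.num
        (fun x => σ.filter fun y => Γ'.graph.Adj x (e y)) m T).symm)
    refine card_filter_eq_of_card_filter_subset_eq _ _ (fun x => σ.filter fun y => Γ.graph.Adj x y)
      (fun x => σ.filter fun y => Γ'.graph.Adj x (e y)) (fun T => ?_) T
    by_cases hT : T ⊆ σ
    · have := card_outside_eq h he hσ hσ' hT m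
      rw [Finset.filter_filter, Finset.filter_filter]
      convert this using 4 with x x <;>
      · simp only [Finset.subset_iff, Finset.mem_filter]
        exact ⟨fun h y hy => (h hy).2, fun h y hy => ⟨hT hy, h y hy⟩⟩
    -- Adjacency patterns are subsets of `σ`, so both counts vanish.
    · rw [Finset.filter_false_of_mem, Finset.filter_false_of_mem]
      · simp
      · intro x _ hx
        exact hT (hx.trans (Finset.filter_subset _ _))
      · intro x _ hx
        exact hT (hx.trans (Finset.filter_subset _ _)))
  have hp : ∀ x, p x ↔ p' (e x) := fun x => by simp [p, p']
  let f : V ≃ V' := (Equiv.sumCompl p).symm.trans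
    ((Equiv.sumCongr (e.subtypeEquiv hp) g).trans (Equiv.sumCompl p'))
  have f_in : ∀ x, x ∈ σ → f x = e x := by
    intro x hx
    simp [f, Equiv.sumCompl_symm_apply_of_pos (p := p) hx]
  have f_out : ∀ (x) (hx : ¬ p x), f x = g ⟨x, hx⟩ := by
    intro x hx
    simp [f, Equiv.sumCompl_symm_apply_of_neg (p := p) hx]
  refine ⟨f, fun x => ?_, f_in, fun x y hy => ?_⟩
  · by_cases hx : x ∈ σ
    · rw [f_in x hx, he]
    · rw [f_out x hx]
      exact (Prod.ext_iff.mp (hg ⟨x, hx⟩)).1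
  · rw [f_in y hy]
    by_cases hx : x ∈ σ
    · rw [f_in x hx]
      by_cases hxy : x = y
      · simp [hxy]
      · refine iff_of_true (hσ' ?_ ?_ (fun h => hxy (e.injective h))) (hσ hx hy hxy) <;> simpa
    · rw [f_out x hx]
      have := (Prod.ext_iff.mp (hg ⟨x, hx⟩)).2
      have := congrArg (y ∈ ·) this
      simpa [F, F', hy] using this

open Classical in
/-- The support of a state. -/
noncomputable def support (t : V → ℤ) : Finset V := Finset.univ.filter fun x => t x ≠ 0

-- Only the vertex just read and old support vertices adjacent to it can survive.
omit [Fintype V'] in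
theorem isClique_support_step {t : V → ℤ} (ht : Γ.IsClique (support t)) (a : V × ℤˣ) :
    Γ.IsClique (support (Γ.step t a)) := by
  intro x hx y hy hxy
  rw [Finset.mem_coe, support, Finset.mem_filter] at hx hy
  simp only [Finset.mem_univ, true_and, step] at hx hy
  have H : ∀ x y, t x ≠ 0 → t y ≠ 0 → x ≠ y → Γ.graph.Adj x y := fun x y h1 h2 h3 =>
    ht (by simpa [support]) (by simpa [support]) h3
  split_ifs at hx hy with h1 h2 h3 h4 h5 h6
  · exact absurd (h1.trans h2.symm) hxy
  · rw [h1]; exact h3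
  · exact absurd rfl hy
  · rw [h5]; exact h4.symm
  · exact H x y hx hy hxy
  · exact absurd rfl hy
  all_goals exact absurd rfl hx

/-- In equivalent numbered graphs, states that correspond under a number-preserving bijection
admit equally many words of every length. -/
theorem acceptedCount_eq (h : Γ.Equivalent Γ') (n : ℕ) {t : V → ℤ} {t' : V' → ℤ} (e : V ≃ V')
    (he : ∀ x, Γ'.num (e x) = Γ.num x) (ht : ∀ x, t' (e x) = t x)
    (hc : Γ.IsClique (support t)) (hc' : Γ'.IsClique (support t')) :
    Γ.acceptedCount n t = Γ'.acceptedCount n t' := by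
  classical
  induction n generalizing t t' e with
  | zero => rfl
  | succ n ih =>
    have hmap : (support t).map e.toEmbedding = support t' := by
      ext x
      obtain ⟨x, rfl⟩ := e.surjective x
      simp [support, ht]
    obtain ⟨f, hf, hfe, hadj⟩ := exists_equiv_adj_iff h he hc (by rwa [hmap])
    have hft : ∀ x, t' (f x) = t x := by
      intro x
      by_cases hx : x ∈ support t
      · rw [hfe x hx, ht]
      -- Since `f` already maps the support of `t` onto that of `t'`, injectivity keeps every other
      -- vertex out of it.
      · have h0 : t x = 0 := by simpa [support] using hx
        by_contra hne
        have hm : f x ∈ (support t).map e.toEmbedding := by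
          rw [hmap]
          simp only [support, Finset.mem_filter, Finset.mem_univ, true_and]
          rwa [h0] at hne
        obtain ⟨y, hy, hyx⟩ := Finset.mem_map.mp hm
        have : f y = f x := by rw [hfe y hy]; exact hyx
        exact hx (f.injective this ▸ hy)
    rw [acceptedCount, acceptedCount]
    refine Fintype.sum_equiv (f.prodCongr (Equiv.refl _)) _ _ ?_
    rintro ⟨u, s⟩
    have hA : Γ.Allowed t (u, s) ↔ Γ'.Allowed t' (f u, s) := by
      simp [Allowed, hf, hft]
    refine if_congr hA (ih f hf (fun x => ?_) (isClique_support_step hc _)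
      (isClique_support_step hc' _)) rfl
    simp only [step, Equiv.prodCongr_apply, Prod.map_apply, Equiv.refl_apply,
      f.injective.eq_iff, hft]
    -- Away from the letter read, adjacency affects the new state only where the old exponent is
    -- nonzero, which is where `f` respects it.
    by_cases hx : x ∈ support t
    · simp only [hadj u x hx]
    · have h0 : t x = 0 := by simpa [support] using hx
      simp [h0]

theorem acceptedCount_zero_eq (h : Γ.Equivalent Γ') (n : ℕ) :
    Γ.acceptedCount n 0 = Γ'.acceptedCount n 0 := by
  classical
  obtain ⟨e, he⟩ := exists_equiv_comp_eq Γ.num Γ'.num (by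
    intro m
    have := congrArg (Multiset.count m) h.numbers_univ
    simp only [numbers, Multiset.count_map] at this
    rw [Nat.card_eq_fintype_card, Nat.card_eq_fintype_card, Fintype.card_subtype,
      Fintype.card_subtype]
    simpa only [Finset.card_def, Finset.filter_val, eq_comm (a := m)] using this)
  refine acceptedCount_eq h n e he (fun _ => rfl) ?_ ?_ <;>
  · simp [IsClique, support]

end Comparison

end NumberedGraph

/-! ### Norm and first letter in a free product of cyclic groups. -/

section FreeProduct

open Monoid

/-- The free product of copies of the cyclic group of order `n`, indexed by `Q`. -/
abbrev CyclicFreeProduct (Q : Type*) (n : ℕ) : Type _ :=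
  CoprodI fun _ : Q => Multiplicative (ZMod n)

namespace CyclicFreeProduct

variable {Q : Type*} {n : ℕ}

/-- The element `m` of the factor with index `q`. -/
def single (q : Q) (m : ZMod n) : CyclicFreeProduct Q n :=
  CoprodI.of (M := fun _ : Q => Multiplicative (ZMod n)) (i := q) (Multiplicative.ofAdd m)

theorem single_add (q : Q) (m m' : ZMod n) : single q (m + m') = single q m * single q m' := by
  simp [single]

theorem single_zero (q : Q) : single q (0 : ZMod n) = 1 := by
  simp [single]

theorem single_neg (q : Q) (m : ZMod n) : single q (-m) = (single q m)⁻¹ := by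
  rw [eq_inv_iff_mul_eq_one, ← single_add, neg_add_cancel, single_zero]

theorem single_nsmul (q : Q) (m : ZMod n) (k : ℕ) : single q (k • m) = single q m ^ k := by
  induction k with
  | zero => simp [single_zero]
  | succ k ih => rw [succ_nsmul, single_add, ih, pow_succ]

/-- The sum over the letters of a reduced word of their distances from zero. -/
def wordNorm (W : CoprodI.Word fun _ : Q => Multiplicative (ZMod n)) : ℕ :=
  (W.toList.map fun l => (Multiplicative.toAdd l.2).valMinAbs.natAbs).sum

open Classical in
/-- The length of an element with respect to the standard generators of the factors. -/
noncomputable def norm (x : CyclicFreeProduct Q n) : ℕ := wordNorm (CoprodI.Word.equiv x)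

open Classical in
/-- The first letter of the reduced word of `x` if it has index `q`, zero otherwise. -/
noncomputable def head (q : Q) (x : CyclicFreeProduct Q n) : ZMod n :=
  Multiplicative.toAdd (CoprodI.Word.equivPair q (CoprodI.Word.equiv x)).head

theorem norm_one : norm (1 : CyclicFreeProduct Q n) = 0 := by
  classical
  simp [norm, wordNorm, CoprodI.Word.equiv]

theorem head_one (q : Q) : head q (1 : CyclicFreeProduct Q n) = 0 := by
  classical
  have : (CoprodI.Word.empty (M := fun _ : Q => Multiplicative (ZMod n))).fstIdx ≠ some q := by
    simp [CoprodI.Word.fstIdx]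
  simp [head, CoprodI.Word.equiv, CoprodI.Word.equivPair_eq_of_fstIdx_ne this]

open Classical in
theorem wordNorm_rcons {q : Q} (p : CoprodI.Word.Pair (fun _ : Q => Multiplicative (ZMod n)) q) :
    wordNorm (CoprodI.Word.rcons p) =
      (Multiplicative.toAdd p.head).valMinAbs.natAbs + wordNorm p.tail := by
  rw [CoprodI.Word.rcons]
  split_ifs with h
  · simp [h]
  · simp [wordNorm]

open Classical in
theorem equiv_single_mul (q : Q) (m : ZMod n) (x : CyclicFreeProduct Q n) :
    CoprodI.Word.equiv (single q m * x) = CoprodI.of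
      (M := fun _ : Q => Multiplicative (ZMod n)) (i := q) (Multiplicative.ofAdd m) •
        CoprodI.Word.equiv x := by
  simp only [CoprodI.Word.equiv, Equiv.coe_fn_mk, single, mul_smul]

/-- Only the first syllable changes, from `head q x` to `m + head q x`; the tail is common to both
sides. -/
theorem norm_single_mul (q : Q) (m : ZMod n) (x : CyclicFreeProduct Q n) :
    norm (single q m * x) + (head q x).valMinAbs.natAbs =
      norm x + (m + head q x).valMinAbs.natAbs := by
  classical
  have h1 : norm x = (head q x).valMinAbs.natAbs +
      wordNorm (CoprodI.Word.equivPair q (CoprodI.Word.equiv x)).tail := by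
    rw [head, ← wordNorm_rcons, ← CoprodI.Word.equivPair_symm, Equiv.symm_apply_apply, norm]
  have h2 : norm (single q m * x) = (m + head q x).valMinAbs.natAbs +
      wordNorm (CoprodI.Word.equivPair q (CoprodI.Word.equiv x)).tail := by
    rw [norm, equiv_single_mul, CoprodI.Word.of_smul_def, wordNorm_rcons]
    simp [head]
  omega

theorem head_single_mul_self (q : Q) (m : ZMod n) (x : CyclicFreeProduct Q n) :
    head q (single q m * x) = m + head q x := by
  classical
  rw [head, equiv_single_mul, CoprodI.Word.equivPair_smul_same]
  simp [head]

/-- By `hm` a syllable of index `q` survives in front, so no syllable of another index is exposed.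
-/
theorem head_single_mul_of_ne {q q' : Q} (m : ZMod n) (x : CyclicFreeProduct Q n) (hq : q' ≠ q)
    (hm : m + head q x ≠ 0) : head q' (single q m * x) = 0 := by
  classical
  have hm' : Multiplicative.ofAdd m * (CoprodI.Word.equivPair q (CoprodI.Word.equiv x)).head ≠ 1 :=
    fun h => hm (congrArg Multiplicative.toAdd h)
  rw [head, equiv_single_mul, CoprodI.Word.of_smul_def, CoprodI.Word.rcons, dif_neg hm',
    CoprodI.Word.equivPair_eq_of_fstIdx_ne]
  · rfl
  · rw [CoprodI.Word.fstIdx_cons]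
    simpa using hq.symm

theorem norm_single_mul_le (q : Q) (m : ZMod n) (x : CyclicFreeProduct Q n) :
    norm (single q m * x) ≤ norm x + m.valMinAbs.natAbs := by
  have h1 := norm_single_mul q m x
  have h2 := ZMod.natAbs_valMinAbs_add_le m (head q x)
  have h3 := Int.natAbs_add_le m.valMinAbs (head q x).valMinAbs
  omega

variable {G : Type*} [Group G] [MulAction G Q]

theorem hom_ext {N : Type*} [Monoid N] {f g : CyclicFreeProduct Q n →* N}
    (h : ∀ q m, f (single q m) = g (single q m)) : f = g :=
  CoprodI.ext_hom _ _ fun q => MonoidHom.ext fun m => h q (Multiplicative.toAdd m)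

/-- The endomorphism of a free product that permutes the factors. -/
def permHom (g : G) : CyclicFreeProduct Q n →* CyclicFreeProduct Q n :=
  CoprodI.lift fun q => CoprodI.of (M := fun _ : Q => Multiplicative (ZMod n)) (i := g • q)

theorem permHom_single (g : G) (q : Q) (m : ZMod n) :
    permHom g (single q m) = single (g • q) m :=
  CoprodI.lift_of _ _

variable (Q n G) in
/-- The action on a free product that permutes the factors. -/
def permAut : G →* MulAut (CyclicFreeProduct Q n) where
  toFun g := MonoidHom.toMulEquiv (permHom g) (permHom g⁻¹)
    (hom_ext fun q m => by simp [permHom_single]) (hom_ext fun q m => by simp [permHom_single])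
  map_one' := by
    ext x
    exact DFunLike.congr_fun (f := permHom (1 : G)) (g := MonoidHom.id _)
      (hom_ext fun q m => by simp [permHom_single]) x
  map_mul' g h := by
    ext x
    exact DFunLike.congr_fun (f := permHom (g * h)) (g := (permHom g).comp (permHom h))
      (hom_ext fun q m => by simp [permHom_single, mul_smul]) x

theorem permAut_single (g : G) (q : Q) (m : ZMod n) :
    permAut Q n G g (single q m) = single (g • q) m :=
  permHom_single g q m

end CyclicFreeProduct

end FreeProduct

/-! ### Minimal absolute residues. -/

section ZMod

theorem natAbs_valMinAbs_intCast {n : ℕ} (k : ℤ) (hk : 2 * k.natAbs ≤ n) :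
    (k : ZMod n).valMinAbs.natAbs = k.natAbs := by
  have h : k.natAbs ≤ n / 2 := by omega
  rcases k.natAbs_eq with hk' | hk'
  · rw [hk', Int.cast_natCast, ZMod.valMinAbs_natCast_of_le_half h]
  · rw [hk', Int.cast_neg, ZMod.natAbs_valMinAbs_neg, Int.cast_natCast,
      ZMod.valMinAbs_natCast_of_le_half h, Int.natAbs_neg]

theorem natAbs_valMinAbs_unit_le {n : ℕ} (hn : 0 < n) (s : ℤˣ) :
    ((s : ℤ) : ZMod n).valMinAbs.natAbs ≤ 1 := by
  obtain rfl | hn : n = 1 ∨ 2 ≤ n := by omega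
  · rw [Subsingleton.elim ((s : ℤ) : ZMod 1) 0]
    simp
  · rw [natAbs_valMinAbs_intCast _ (by simpa using hn)]
    simp

end ZMod

/-! ### The splitting at a vertex and the lower bound on letter counts. -/

namespace NumberedGraph

variable {V : Type u} (Γ : NumberedGraph V)

/-- The group element of a letter. -/
def letter (a : V × ℤˣ) : Γ.NGP := Γ.gen a.1 ^ (a.2 : ℤ)

/-- The group element represented by a word. -/
def value (w : List (V × ℤˣ)) : Γ.NGP := (w.map Γ.letter).prod

open Classical in
/-- The number of letters `x` and `x⁻¹` in a word. -/
noncomputable def letterCount (x : V) (w : List (V × ℤˣ)) : ℕ := (w.map Prod.fst).count x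

theorem value_append (w w' : List (V × ℤˣ)) : Γ.value (w ++ w') = Γ.value w * Γ.value w' := by
  simp [value]

theorem value_concat (w : List (V × ℤˣ)) (a : V × ℤˣ) :
    Γ.value (w ++ [a]) = Γ.value w * Γ.letter a := by
  simp [value]

theorem value_nil : Γ.value [] = 1 := rfl

theorem letterCount_concat_self (x : V) (s : ℤˣ) (w : List (V × ℤˣ)) :
    letterCount x (w ++ [(x, s)]) = letterCount x w + 1 := by
  simp [letterCount]

theorem letterCount_concat_of_ne {x u : V} (h : u ≠ x) (s : ℤˣ) (w : List (V × ℤˣ)) :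
    letterCount x (w ++ [(u, s)]) = letterCount x w := by
  simp [letterCount, h]

theorem sum_letterCount [Fintype V] (w : List (V × ℤˣ)) : ∑ x, letterCount x w = w.length := by
  classical
  induction w with
  | nil => simp [letterCount]
  | cons a w ih =>
    simp only [letterCount, List.map_cons, List.count_cons, Finset.sum_add_distrib,
      List.length_cons] at ih ⊢
    rw [ih]
    simp

theorem gen_pow_num (x : V) : Γ.gen x ^ Γ.num x = 1 :=
  (PresentedGroup.one_of_mem (rels := Γ.relators) (x := FreeGroup.of x ^ Γ.num x)
    (Or.inl ⟨x, rfl⟩))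

theorem gen_commute {x y : V} (h : Γ.graph.Adj x y) : Commute (Γ.gen x) (Γ.gen y) := by
  have : Γ.gen x * Γ.gen y * (Γ.gen x)⁻¹ * (Γ.gen y)⁻¹ = 1 :=
    PresentedGroup.one_of_mem (rels := Γ.relators)
      (x := FreeGroup.of x * FreeGroup.of y * (FreeGroup.of x)⁻¹ * (FreeGroup.of y)⁻¹)
      (Or.inr ⟨x, y, h, rfl⟩)
  rw [mul_inv_eq_one, mul_inv_eq_iff_eq_mul] at this
  exact this

/-- The subgroup generated by the link of a vertex. -/
def linkSubgroup (v : V) : Subgroup Γ.NGP :=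
  Subgroup.closure {g | ∃ u, Γ.graph.Adj v u ∧ g = Γ.gen u}

/-- The cosets of the subgroup generated by the link of a vertex. -/
abbrev LinkCoset (v : V) : Type u := Γ.NGP ⧸ Γ.linkSubgroup v

/-- The free product of copies of the vertex group of `v`, indexed by the cosets of the link of
`v`, extended by the numbered graph product. -/
abbrev CosetProduct (v : V) : Type u :=
  CyclicFreeProduct (Γ.LinkCoset v) (Γ.num v) ⋊[CyclicFreeProduct.permAut _ _ Γ.NGP] Γ.NGP

open CyclicFreeProduct SemidirectProduct

open Classical in
/-- The images of the generators under `splitting`. -/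
noncomputable def splittingGen (v u : V) : Γ.CosetProduct v :=
  if u = v then inl (single ((1 : Γ.NGP) : Γ.LinkCoset v) 1) else inr (Γ.gen u)

/-- A neighbour of `v` lies in the link subgroup, so it fixes the trivial coset and hence the factor
indexed by it. -/
theorem splittingGen_commute {v u : V} (h : Γ.graph.Adj v u) :
    Commute (Γ.splittingGen v v) (Γ.splittingGen v u) := by
  rw [splittingGen, if_pos rfl, splittingGen, if_neg h.ne']
  have : (Γ.gen u • ((1 : Γ.NGP) : Γ.LinkCoset v)) = ((1 : Γ.NGP) : Γ.LinkCoset v) := by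
    rw [MulAction.Quotient.smul_coe, eq_comm, QuotientGroup.eq]
    have : Γ.gen u ∈ Γ.linkSubgroup v := Subgroup.subset_closure ⟨u, h, rfl⟩
    simpa using this
  refine SemidirectProduct.ext ?_ ?_
  · simp [permAut_single, this]
  · simp

/-- The homomorphism that sends `v` to the generator of the factor of the free product with the
trivial coset as its index, and all other vertices to themselves. -/
noncomputable def splitting (v : V) : Γ.NGP →* Γ.CosetProduct v :=
  PresentedGroup.toGroup (f := Γ.splittingGen v) (by
    rintro r (⟨x, rfl⟩ | ⟨x, y, hxy, rfl⟩)
    · rw [map_pow, FreeGroup.lift_apply_of]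
      by_cases hx : x = v
      · subst hx
        rw [splittingGen, if_pos rfl, ← map_pow, ← single_nsmul]
        simp [single_zero]
      · rw [splittingGen, if_neg hx, ← map_pow, gen_pow_num, map_one]
    · simp only [map_mul, map_inv, FreeGroup.lift_apply_of]
      rw [mul_inv_eq_one, mul_inv_eq_iff_eq_mul]
      by_cases hx : x = v
      · subst hx
        exact Γ.splittingGen_commute hxy
      · by_cases hy : y = v
        · subst hy
          exact (Γ.splittingGen_commute hxy.symm).symm
        · rw [splittingGen, if_neg hx, splittingGen, if_neg hy]
          exact (Γ.gen_commute hxy).map inr)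

theorem splitting_gen (v u : V) : Γ.splitting v (Γ.gen u) = Γ.splittingGen v u :=
  PresentedGroup.toGroup.of _

/-- The inverse of the component of an element in the free product. -/
noncomputable def cosetPart (v : V) (g : Γ.NGP) : CyclicFreeProduct (Γ.LinkCoset v) (Γ.num v) :=
  (Γ.splitting v g).left⁻¹

/-- The coset of the retraction of an element. -/
noncomputable def coset (v : V) (g : Γ.NGP) : Γ.LinkCoset v := ((Γ.splitting v g).right : Γ.NGP)

theorem splitting_letter_self (v : V) (s : ℤˣ) :
    Γ.splitting v (Γ.letter (v, s)) =
      inl (single ((1 : Γ.NGP) : Γ.LinkCoset v) ((s : ℤ) : ZMod _)) := by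
  rw [letter, map_zpow, splitting_gen, splittingGen, if_pos rfl]
  rcases Int.units_eq_one_or s with rfl | rfl
  · simp
  · simp [single_neg]

theorem splitting_letter_of_ne {v u : V} (h : u ≠ v) (s : ℤˣ) :
    Γ.splitting v (Γ.letter (u, s)) = inr (Γ.letter (u, s)) := by
  rw [letter, map_zpow, splitting_gen, splittingGen, if_neg h, map_zpow]

theorem splitting_value_of_letterCount_eq_zero {v : V} {w : List (V × ℤˣ)}
    (h : letterCount v w = 0) : Γ.splitting v (Γ.value w) = inr (Γ.value w) := by
  induction w using List.reverseRecOn with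
  | nil => simp [value]
  | append_singleton w a ih =>
    obtain ⟨u, s⟩ := a
    by_cases hu : u = v
    · subst hu
      rw [letterCount_concat_self] at h
      omega
    · rw [letterCount_concat_of_ne hu] at h
      rw [value_concat, map_mul, ih h, splitting_letter_of_ne _ hu, map_mul]

/-- The inverse in `cosetPart` turns right multiplication in the group into left multiplication,
which acts on the first syllable. -/
theorem cosetPart_mul_letter_self (v : V) (s : ℤˣ) (g : Γ.NGP) :
    Γ.cosetPart v (g * Γ.letter (v, s)) =
      single (Γ.coset v g) ((-(s : ℤ) : ℤ) : ZMod (Γ.num v)) * Γ.cosetPart v g := by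
  rw [cosetPart, map_mul, splitting_letter_self, mul_left, left_inl, permAut_single, mul_inv_rev,
    Int.cast_neg, single_neg, MulAction.Quotient.smul_coe, smul_eq_mul, mul_one]
  rfl

theorem coset_mul_letter_self (v : V) (s : ℤˣ) (g : Γ.NGP) :
    Γ.coset v (g * Γ.letter (v, s)) = Γ.coset v g := by
  rw [coset, map_mul, splitting_letter_self, mul_right, right_inl, mul_one]
  rfl

theorem cosetPart_mul_of_splitting {v : V} {h : Γ.NGP} (hh : Γ.splitting v h = inr h)
    (g : Γ.NGP) : Γ.cosetPart v (g * h) = Γ.cosetPart v g := by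
  rw [cosetPart, map_mul, hh, mul_left, left_inr, map_one, mul_one]
  rfl

theorem coset_mul_eq_iff {v : V} {h : Γ.NGP} (hh : Γ.splitting v h = inr h) (g : Γ.NGP) :
    Γ.coset v (g * h) = Γ.coset v g ↔ h ∈ Γ.linkSubgroup v := by
  rw [coset, coset, map_mul, hh, mul_right, right_inr, eq_comm, QuotientGroup.eq,
    inv_mul_cancel_left]

theorem cosetPart_one (v : V) : Γ.cosetPart v 1 = 1 := by
  simp [cosetPart]

theorem splitting_of_mem_linkSubgroup {u v : V} (hne : u ≠ v) (h : ¬ Γ.graph.Adj u v) {g : Γ.NGP}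
    (hg : g ∈ Γ.linkSubgroup v) : Γ.splitting u g = inr g := by
  induction hg using Subgroup.closure_induction with
  | mem x hx =>
    obtain ⟨y, hy, rfl⟩ := hx
    rw [splitting_gen, splittingGen, if_neg]
    rintro rfl
    exact h hy.symm
  | one => simp
  | mul x y _ _ hx hy => rw [map_mul, hx, hy, map_mul]
  | inv x _ hx => rw [map_inv, hx, map_inv]

/-- Each `v`-letter multiplies by an element of norm at most one; other letters leave the component
unchanged. -/
theorem norm_cosetPart_value_le (v : V) (w : List (V × ℤˣ)) :
    norm (Γ.cosetPart v (Γ.value w)) ≤ letterCount v w := by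
  induction w using List.reverseRecOn with
  | nil => simp [value_nil, cosetPart_one, norm_one]
  | append_singleton w a ih =>
    obtain ⟨u, s⟩ := a
    rw [value_concat]
    by_cases hu : u = v
    · subst hu
      rw [letterCount_concat_self, cosetPart_mul_letter_self]
      refine (norm_single_mul_le _ _ _).trans (Nat.add_le_add ih ?_)
      have := natAbs_valMinAbs_unit_le (Γ.num_pos u) (-s)
      simpa using this
    · rw [letterCount_concat_of_ne hu,
        cosetPart_mul_of_splitting _ (Γ.splitting_letter_of_ne hu s)]
      exact ih

/-! ### Accepted words attain the lower bound; other words can be shortened. -/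

variable {Γ}

theorem Allowed.natAbs_add_le {t : V → ℤ} {v : V} {s : ℤˣ} (h : Γ.Allowed t (v, s)) :
    2 * (t v + s).natAbs ≤ Γ.num v ∧ (t v + s).natAbs = (t v).natAbs + 1 := by
  obtain ⟨h1, h2, -⟩ := h
  rcases Int.units_eq_one_or s with rfl | rfl <;> simp at h1 h2 ⊢ <;> omega

/-- The states compared entrywise: the exponents of `t₀` lie between zero and those of `t`. -/
def StateLE (t₀ t : V → ℤ) : Prop := ∀ x, (0 ≤ t₀ x ∧ t₀ x ≤ t x) ∨ (t x ≤ t₀ x ∧ t₀ x ≤ 0)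

theorem Allowed.mono {t₀ t : V → ℤ} (h : StateLE t₀ t) {a : V × ℤˣ} (ha : Γ.Allowed t a) :
    Γ.Allowed t₀ a := by
  obtain ⟨v, s⟩ := a
  obtain ⟨h1, h2, h3⟩ := ha
  refine ⟨?_, ?_, h3⟩ <;> have := h v <;>
  rcases Int.units_eq_one_or s with rfl | rfl <;> simp at h1 h2 ⊢ <;> omega

theorem StateLE.step {t₀ t : V → ℤ} (h : StateLE t₀ t) {a : V × ℤˣ} (ha : Γ.Allowed t a) :
    StateLE (Γ.step t₀ a) (Γ.step t a) := by
  obtain ⟨v, s⟩ := a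
  intro x
  simp only [NumberedGraph.step]
  have hx := h x
  split_ifs with h1
  · subst h1
    obtain ⟨h1, h2, -⟩ := ha
    rcases Int.units_eq_one_or s with rfl | rfl <;> simp at h1 h2 ⊢ <;> omega
  · exact hx
  · simp

theorem Accepts.mono {t₀ t : V → ℤ} (h : StateLE t₀ t) {w : List (V × ℤˣ)} (hw : Γ.Accepts t w) :
    Γ.Accepts t₀ w := by
  induction w generalizing t₀ t with
  | nil => trivial
  | cons a w ih => exact ⟨hw.1.mono h, ih (h.step hw.1) hw.2⟩

/-- The zero state is least for `StateLE`; hence suffixes of accepted words are accepted from zero.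
-/
theorem Accepts.zero {t : V → ℤ} {w : List (V × ℤˣ)} (hw : Γ.Accepts t w) : Γ.Accepts 0 w :=
  hw.mono fun x => by simp only [Pi.zero_apply]; omega

theorem exists_eq_append_of_letterCount_ne_zero {v : V} {w : List (V × ℤˣ)}
    (h : letterCount v w ≠ 0) : ∃ p s r, w = p ++ [(v, s)] ++ r ∧ letterCount v r = 0 := by
  induction w using List.reverseRecOn with
  | nil => simp [letterCount] at h
  | append_singleton w a ih =>
    obtain ⟨u, s⟩ := a
    by_cases hu : u = v
    · subst hu
      exact ⟨w, s, [], by simp, by simp [letterCount]⟩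
    · rw [letterCount_concat_of_ne hu] at h
      obtain ⟨p, s', r, rfl, hr⟩ := ih h
      exact ⟨p, s', r ++ [(u, s)], by simp, by rwa [letterCount_concat_of_ne hu]⟩

/-- In the free product of the splitting at `v`, an accepted word has the length that its letters
from `v` suggest, and the first letter of its reduced word is read off from the state. -/
theorem norm_and_head_of_accepts (v : V) {w : List (V × ℤˣ)} (hw : Γ.Accepts 0 w) :
    norm (Γ.cosetPart v (Γ.value w)) = letterCount v w ∧
      head (Γ.coset v (Γ.value w)) (Γ.cosetPart v (Γ.value w)) =
        ((-Γ.run 0 w v : ℤ) : ZMod (Γ.num v)) := by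
  -- The vertex is generalised because the non-adjacent case applies the hypothesis to a shorter
  -- word at `u`.
  induction hn : w.length using Nat.strong_induction_on generalizing v w with
  | _ n ih =>
  subst hn
  rcases List.eq_nil_or_concat' w with rfl | ⟨w, ⟨u, s⟩, rfl⟩
  · simp [value_nil, cosetPart_one, norm_one, head_one, letterCount, run]
  obtain ⟨hw', ha⟩ := accepts_concat.mp hw
  obtain ⟨ih1, ih2⟩ := ih w.length (by simp) v hw' rfl
  rw [value_concat, run_concat]
  by_cases hu : u = v
  · subst hu
    obtain ⟨hle, hadd⟩ := ha.natAbs_add_le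
    rw [cosetPart_mul_letter_self, coset_mul_letter_self, letterCount_concat_self,
      head_single_mul_self, step_self, ih2, ← Int.cast_add]
    have hsum : (-(s : ℤ) + -Γ.run 0 w u) = -(Γ.run 0 w u + s) := by ring
    refine ⟨?_, by rw [hsum]⟩
    have key := norm_single_mul (Γ.coset u (Γ.value w)) ((-(s : ℤ) : ℤ) : ZMod (Γ.num u))
      (Γ.cosetPart u (Γ.value w))
    -- Both exponents are at most half the order, so their absolute values are the residue norms and
    -- the norm grows by exactly one.
    rw [ih2, ← Int.cast_add, hsum,
      natAbs_valMinAbs_intCast (-(Γ.run 0 w u + s)) (by rwa [Int.natAbs_neg]),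
      natAbs_valMinAbs_intCast _ (by rw [Int.natAbs_neg]; omega), Int.natAbs_neg, Int.natAbs_neg,
      ih1] at key
    omega
  · have hs := Γ.splitting_letter_of_ne hu s
    rw [cosetPart_mul_of_splitting _ hs, letterCount_concat_of_ne hu]
    refine ⟨ih1, ?_⟩
    by_cases hadj : Γ.graph.Adj u v
    · rw [step_of_adj _ _ hadj, (Γ.coset_mul_eq_iff hs _).mpr, ih2]
      have : Γ.gen u ∈ Γ.linkSubgroup v := Subgroup.subset_closure ⟨u, hadj.symm, rfl⟩
      exact Subgroup.zpow_mem _ this _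
    · rw [step_of_not_adj _ _ hu hadj, neg_zero, Int.cast_zero]
      by_cases hc : letterCount v w = 0
      · have := Γ.splitting_value_of_letterCount_eq_zero hc
        have h1 := Γ.cosetPart_mul_of_splitting this 1
        rw [one_mul, cosetPart_one] at h1
        rw [h1, head_one]
      -- Cut at the last `v`-letter: its syllable is in front at the coset of `p`, so it suffices
      -- that the present coset differs and that this syllable is nonzero.
      · obtain ⟨p, s', r, rfl, hr⟩ := exists_eq_append_of_letterCount_ne_zero hc
        have hp := (accepts_append.mp hw').1
        obtain ⟨hp', ha'⟩ := accepts_concat.mp hp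
        have hr' : letterCount v (r ++ [(u, s)]) = 0 := by rwa [letterCount_concat_of_ne hu]
        have hru : Γ.Accepts 0 (r ++ [(u, s)]) := by
          rw [List.append_assoc] at hw
          exact (accepts_append.mp hw).2.zero
        have hsr := Γ.splitting_value_of_letterCount_eq_zero hr
        have hsru := Γ.splitting_value_of_letterCount_eq_zero hr'
        obtain ⟨-, ihp⟩ := ih p.length (by simp) v hp' rfl
        rw [← value_concat, List.append_assoc, value_append _ _ (r ++ [(u, s)]),
          value_append _ _ r, cosetPart_mul_of_splitting _ hsr, value_concat _ p,
          cosetPart_mul_letter_self]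
        refine head_single_mul_of_ne _ _ (fun heq => ?_) (fun h0 => ?_)
        · rw [← Γ.coset_mul_letter_self v s' (Γ.value p), coset_mul_eq_iff _ hsru] at heq
          -- Equal cosets would put `r` followed by `u` in the link subgroup of `v`, where the
          -- component at `u` is trivial; yet its norm counts at least one `u`.
          obtain ⟨ihr, -⟩ := ih (r ++ [(u, s)]).length (by simp; omega) u hru rfl
          have h1 := Γ.cosetPart_mul_of_splitting (Γ.splitting_of_mem_linkSubgroup hu hadj heq) 1
          rw [one_mul, cosetPart_one] at h1
          rw [h1, norm_one, letterCount_concat_self] at ihr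
          omega
        · obtain ⟨hle, hadd⟩ := ha'.natAbs_add_le
          have hsum : (-(s' : ℤ) + -Γ.run 0 p v) = -(Γ.run 0 p v + s') := by ring
          rw [ihp, ← Int.cast_add, hsum] at h0
          have := natAbs_valMinAbs_intCast (n := Γ.num v) (-(Γ.run 0 p v + s'))
            (by rwa [Int.natAbs_neg])
          rw [h0, ZMod.valMinAbs_zero, Int.natAbs_neg] at this
          simp only [Int.natAbs_zero] at this
          omega

/-- An accepted word has the minimal number of letters from each vertex among the words that
represent the same element. -/
theorem letterCount_le_of_accepts {w z : List (V × ℤˣ)} (hw : Γ.Accepts 0 w)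
    (h : Γ.value z = Γ.value w) (v : V) : letterCount v w ≤ letterCount v z := by
  rw [← (norm_and_head_of_accepts v hw).1, ← h]
  exact Γ.norm_cosetPart_value_le v z

theorem length_le_of_accepts [Fintype V] {w z : List (V × ℤˣ)} (hw : Γ.Accepts 0 w)
    (h : Γ.value z = Γ.value w) : w.length ≤ z.length := by
  rw [← sum_letterCount, ← sum_letterCount]
  exact Finset.sum_le_sum fun v _ => letterCount_le_of_accepts hw h v

/-- Letter counts recover the vertex and the head recovers the sign modulo its number; number two is
the ambiguous case, settled by `Allowed`. -/
theorem letter_injOn {a b : V × ℤˣ} (ha : Γ.Allowed 0 a) (hb : Γ.Allowed 0 b)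
    (h : Γ.letter a = Γ.letter b) : a = b := by
  obtain ⟨v, s⟩ := a
  obtain ⟨v', s'⟩ := b
  have hA : Γ.Accepts 0 [(v, s)] := ⟨ha, trivial⟩
  have hB : Γ.Accepts 0 [(v', s')] := ⟨hb, trivial⟩
  have hval : Γ.value [(v, s)] = Γ.value [(v', s')] := by simpa [value] using h
  have hv : v' = v := by
    by_contra hne
    have h1 := letterCount_le_of_accepts hA hval.symm v
    simp [letterCount, hne] at h1
  subst hv
  have h1 := (norm_and_head_of_accepts v' hA).2
  rw [hval, (norm_and_head_of_accepts v' hB).2] at h1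
  simp only [run, List.foldl_cons, List.foldl_nil, step_self, Pi.zero_apply, zero_add] at h1
  have h2 : 2 ≤ Γ.num v' := by
    have := ha.natAbs_add_le.1
    simp at this
    exact this
  obtain ⟨-, -, ha⟩ := ha
  obtain ⟨-, -, hb⟩ := hb
  by_cases h3 : Γ.num v' = 2
  · exact Prod.ext rfl ((ha h3).trans (hb h3).symm)
  · have h4 : s = s' := by
      rw [ZMod.intCast_eq_intCast_iff_dvd_sub] at h1
      have h5 := fun h => Int.le_of_dvd h h1
      have h6 := fun h => Int.le_of_dvd h ((Int.dvd_neg).mpr h1)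
      rcases Int.units_eq_one_or s with rfl | rfl <;>
      rcases Int.units_eq_one_or s' with rfl | rfl <;> simp at h5 h6 ⊢ <;> omega
    rw [h4]

/-- The syllable recorded by the state can be moved to the end of an accepted word. -/
theorem exists_value_eq_mul_zpow (v : V) {w : List (V × ℤˣ)} (hw : Γ.Accepts 0 w) :
    ∃ w', w'.length + (Γ.run 0 w v).natAbs = w.length ∧
      Γ.value w = Γ.value w' * Γ.gen v ^ Γ.run 0 w v := by
  induction w using List.reverseRecOn with
  | nil => exact ⟨[], by simp [run], by simp [run]⟩
  | append_singleton w a ih =>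
    obtain ⟨u, s⟩ := a
    obtain ⟨hw', ha⟩ := accepts_concat.mp hw
    obtain ⟨w', hl, he⟩ := ih hw'
    rw [run_concat, value_concat]
    by_cases hu : u = v
    · subst hu
      refine ⟨w', ?_, ?_⟩
      · have := ha.natAbs_add_le.2
        rw [step_self, List.length_append, List.length_singleton]
        omega
      · rw [step_self, he, letter, mul_assoc, zpow_add]
    · by_cases hadj : Γ.graph.Adj u v
      · refine ⟨w' ++ [(u, s)], ?_, ?_⟩
        · rw [step_of_adj _ _ hadj, List.length_append, List.length_append, List.length_singleton]
          omega
        · rw [step_of_adj _ _ hadj, he, value_concat, mul_assoc, mul_assoc, letter,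
            ((Γ.gen_commute hadj).zpow_zpow _ _).eq]
      · refine ⟨w ++ [(u, s)], ?_, ?_⟩
        · rw [step_of_not_adj _ _ hu hadj]
          simp
        · rw [step_of_not_adj _ _ hu hadj, value_concat, zpow_zero, mul_one]

theorem exists_value_eq_zpow (v : V) (k : ℤ) :
    ∃ w, w.length = k.natAbs ∧ Γ.value w = Γ.gen v ^ k := by
  rcases k.natAbs_eq with hk | hk
  · refine ⟨List.replicate k.natAbs (v, 1), by simp, ?_⟩
    conv_rhs => rw [hk, zpow_natCast]
    simp [value, letter]
  · refine ⟨List.replicate k.natAbs (v, -1), by simp, ?_⟩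
    conv_rhs => rw [hk, zpow_neg, zpow_natCast]
    simp [value, letter]

/-- An accepted word followed by a letter that cannot be read can be shortened. -/
theorem exists_shorter {w : List (V × ℤˣ)} (hw : Γ.Accepts 0 w) {v : V} {s : ℤˣ}
    (hs : Γ.num v = 2 → s = 1) (ha : ¬ Γ.Allowed (Γ.run 0 w) (v, s)) :
    ∃ z, z.length < (w ++ [(v, s)]).length ∧ Γ.value z = Γ.value (w ++ [(v, s)]) := by
  obtain ⟨w', hl, he⟩ := exists_value_eq_mul_zpow v hw
  set t := Γ.run 0 w v with ht
  obtain ⟨k, hk, hkt⟩ : ∃ k : ℤ, k.natAbs ≤ t.natAbs ∧ Γ.gen v ^ k = Γ.gen v ^ (t + s) := by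
    by_cases h1 : 0 ≤ s * t
    -- Going the other way round the cyclic group is no longer than `t`, once `t + s` exceeds half
    -- the order.
    · refine ⟨t + s - s * Γ.num v, ?_, ?_⟩
      · have h2 : ¬ 2 * (s * t + 1) ≤ Γ.num v := fun h2 => ha ⟨h1, h2, hs⟩
        have := Γ.num_pos v
        rcases Int.units_eq_one_or s with rfl | rfl <;> simp at h1 h2 ⊢ <;> omega
      · rw [zpow_sub, mul_comm, zpow_mul, zpow_natCast, gen_pow_num]
        simp
    · refine ⟨t + s, ?_, rfl⟩
      rcases Int.units_eq_one_or s with rfl | rfl <;> simp at h1 ⊢ <;> omega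
  obtain ⟨z, hz, hzv⟩ := exists_value_eq_zpow (Γ := Γ) v k
  refine ⟨w' ++ z, ?_, ?_⟩
  · rw [List.length_append, List.length_append, List.length_singleton]
    omega
  · rw [value_append, hzv, hkt, value_concat, he, zpow_add, mul_assoc, letter]

end NumberedGraph

/-! ### From accepted words to geodesics over the standard generators. -/

section Words

variable {G : Type u} [Group G]

theorem wordEval_append (S : Set G) (w w' : List S) :
    wordEval S (w ++ w') = wordEval S w * wordEval S w' := by
  simp [wordEval]

theorem IsGeodesicWord.of_append {S : Set G} {w w' : List S} (h : IsGeodesicWord S (w ++ w')) :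
    IsGeodesicWord S w := by
  rintro ⟨y, hy, he⟩
  exact h ⟨y ++ w', by simpa using hy, by rw [wordEval_append, wordEval_append, he]⟩

end Words

namespace NumberedGraph

variable {V : Type u} {V' : Type v} (Γ : NumberedGraph V)

theorem letter_mem_stdGens (a : V × ℤˣ) : Γ.letter a ∈ Γ.stdGens := by
  obtain ⟨v, s⟩ := a
  rcases Int.units_eq_one_or s with rfl | rfl
  · exact ⟨v, Or.inl (by simp [letter])⟩
  · exact ⟨v, Or.inr (by simp [letter])⟩

/-- The standard generator of a letter. -/
def stdLetter (a : V × ℤˣ) : Γ.stdGens := ⟨Γ.letter a, Γ.letter_mem_stdGens a⟩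

theorem exists_stdLetter_eq (g : Γ.stdGens) :
    ∃ a, Γ.stdLetter a = g ∧ (Γ.num a.1 = 2 → a.2 = 1) := by
  obtain ⟨g, v, rfl | rfl⟩ := g
  · exact ⟨(v, 1), Subtype.ext (by simp [stdLetter, letter]), fun _ => rfl⟩
  · by_cases h : Γ.num v = 2
    · refine ⟨(v, 1), Subtype.ext ?_, fun _ => rfl⟩
      have := Γ.gen_pow_num v
      rw [h, pow_two] at this
      simpa [stdLetter, letter] using eq_inv_of_mul_eq_one_left this
    · exact ⟨(v, -1), Subtype.ext (by simp [stdLetter, letter]), fun h' => absurd h' h⟩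

theorem wordEval_map_stdLetter (w : List (V × ℤˣ)) :
    wordEval Γ.stdGens (w.map Γ.stdLetter) = Γ.value w := by
  simp only [wordEval, value, List.map_map]
  rfl

theorem exists_map_stdLetter_eq (y : List Γ.stdGens) :
    ∃ w : List (V × ℤˣ), w.map Γ.stdLetter = y :=
  List.map_surjective_iff.mpr (fun g => (Γ.exists_stdLetter_eq g).imp fun _ h => h.1) y

variable {Γ}

theorem Accepts.isGeodesicWord [Fintype V] {w : List (V × ℤˣ)} (hw : Γ.Accepts 0 w) :
    IsGeodesicWord Γ.stdGens (w.map Γ.stdLetter) := by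
  rintro ⟨y, hy, he⟩
  obtain ⟨z, rfl⟩ := Γ.exists_map_stdLetter_eq y
  rw [wordEval_map_stdLetter, wordEval_map_stdLetter] at he
  have := length_le_of_accepts hw he
  simp only [List.length_map] at hy
  omega

/-- Prefixes of geodesics are geodesic, and a first unreadable letter would allow a shortening. -/
theorem exists_accepts_of_isGeodesicWord {y : List Γ.stdGens}
    (hy : IsGeodesicWord Γ.stdGens y) :
    ∃ w : List (V × ℤˣ), Γ.Accepts 0 w ∧ w.map Γ.stdLetter = y := by
  induction y using List.reverseRecOn with
  | nil => exact ⟨[], trivial, rfl⟩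
  | append_singleton y g ih =>
    obtain ⟨w, hw, rfl⟩ := ih hy.of_append
    obtain ⟨⟨v, s⟩, rfl, hs⟩ := Γ.exists_stdLetter_eq g
    refine ⟨w ++ [(v, s)], accepts_concat.mpr ⟨hw, ?_⟩, by simp⟩
    by_contra ha
    obtain ⟨z, hz, he⟩ := exists_shorter hw hs ha
    refine hy ⟨z.map Γ.stdLetter, by simpa using hz, ?_⟩
    rw [wordEval_map_stdLetter, he, ← wordEval_map_stdLetter]
    simp

/-- Letters readable in any state are readable in the zero state, so `letter_injOn` applies at each
position. -/
theorem Accepts.eq_of_map_stdLetter_eq {w w' : List (V × ℤˣ)} {t t' : V → ℤ}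
    (hw : Γ.Accepts t w) (hw' : Γ.Accepts t' w') (h : w.map Γ.stdLetter = w'.map Γ.stdLetter) :
    w = w' := by
  induction w generalizing w' t t' with
  | nil => simpa using h
  | cons a w ih =>
    cases w' with
    | nil => simp at h
    | cons b w' =>
      simp only [List.map_cons, List.cons.injEq] at h
      have ha : Γ.Accepts t [a] := ⟨hw.1, trivial⟩
      have hb : Γ.Accepts t' [b] := ⟨hw'.1, trivial⟩
      rw [letter_injOn ha.zero.1 hb.zero.1 (congrArg Subtype.val h.1), ih hw.2 hw'.2 h.2]

/-- The coefficients of the geodesic growth series count the words accepted by the automaton. -/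
theorem coeff_geodesicGrowthSeries [Fintype V] (n : ℕ) :
    PowerSeries.coeff n (geodesicGrowthSeries Γ.stdGens) = Γ.acceptedCount n 0 := by
  rw [geodesicGrowthSeries, Language.growthSeries, PowerSeries.coeff_mk, ← ncard_accepts]
  symm
  refine Set.ncard_congr (fun w _ => w.map Γ.stdLetter) ?_ ?_ ?_
  · rintro w ⟨hw, rfl⟩
    exact ⟨hw.isGeodesicWord, by simp⟩
  · rintro w w' ⟨hw, _⟩ ⟨hw', _⟩ h
    exact hw.eq_of_map_stdLetter_eq hw' h
  · rintro y ⟨hy, rfl⟩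
    obtain ⟨w, hw, rfl⟩ := exists_accepts_of_isGeodesicWord hy
    exact ⟨w, ⟨hw, by simp⟩, rfl⟩

end NumberedGraph

theorem theorem5p14 {V : Type u} {V' : Type v} [Fintype V] [Fintype V']
    (Γ : NumberedGraph V) (Γ' : NumberedGraph V')
    (hΓ : Γ.LinkRegular) (hΓ' : Γ'.LinkRegular) (hequiv : Γ.Equivalent Γ') :
    geodesicGrowthSeries Γ.stdGens = geodesicGrowthSeries Γ'.stdGens := by
  ext n
  rw [NumberedGraph.coeff_geodesicGrowthSeries, NumberedGraph.coeff_geodesicGrowthSeries,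
    NumberedGraph.acceptedCount_zero_eq hequiv]
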